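/- Let $a_{-1},a_0,a_1,a_2,b>0$, $\gamma,\theta>1$, $T>0$, and let $W$ be a one-dimensional Brownian motion. Put $\lambda=(\theta-1)a_1$ and, for $x>0$, $$F(x)=(\theta-1)\Big[a_2x^{\frac{\gamma-\theta}{1-\theta}}-a_{-1}x^{\frac{\theta+1}{\theta-1}}+a_0x^{\frac{\theta}{\theta-1}}+\tfrac12 b^2\theta x^{-1}\Big].$$ For $N\ge 1$ let $\tau=T/N$, $t_n=n\tau$, $\Delta W_n=W_{t_{n+1}}-W_{t_n}$ and $F^{(\tau)}=F/(1+\tau|F|^2)$. The tamed-splitting scheme with backward-Euler backstop, started from a deterministic $Y_0>0$, forms the proposal $$Z_{n+1}=e^{-\lambda\tau}\big(Y_n+\tau F^{(\tau)}(Y_n)+b(1-\theta)\Delta W_n\big),\qquad 0\le n<N.$$ If $Z_{n+1}>0$, it sets $Y_{n+1}=Z_{n+1}$. If $Z_{n+1}\le 0$, it invokes the backstop: $Y_{n+1}>0$ is a solution of $Y_{n+1}=Y_n+(F(Y_{n+1})-\lambda Y_{n+1})\tau+b(1-\theta)\Delta W_n$. Theorem. Let $0<Y_0\le M_1$, where $M_1$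 is a constant. Then for every $\varepsilon\in(0,1)$ there is $\tau_0>0$ such that for every $N\ge1$ with step size $\tau=T/N\le\tau_0$ and every solution $Y_0,\dots,Y_N$ of the scheme, $$\mathbb P[\mathcal R_N]>1-\varepsilon ,$$ where $\mathcal R_N$ is the event that $Y_0,\dots,Y_N$ are all positive without use of the backstop, that is, $Y_j>0$ for $0\le j\le N$ and $Z_j>0$ for $1\le j\le N$. Equivalently, the probability that the backstop is invoked in at least one of the $N$ steps is less than $\varepsilon$. -/

import Mathlib

open MeasureTheory ProbabilityTheory
open scoped NNReal

noncomputable section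

/-- The positive coefficients of the generalized Ait-Sahalia model
`dX = (aₘ X⁻¹ - a₀ + a₁ X - a₂ X ^ γ) dt + b X ^ θ dW`; here `aₘ` stands for `a_{-1}`. -/
structure AitSahaliaParams where
  aₘ : ℝ
  a₀ : ℝ
  a₁ : ℝ
  a₂ : ℝ
  b : ℝ
  γ : ℝ
  θ : ℝ
  aₘ_pos : 0 < aₘ
  a₀_pos : 0 < a₀
  a₁_pos : 0 < a₁
  a₂_pos : 0 < a₂
  b_pos : 0 < b
  one_lt_γ : 1 < γ
  one_lt_θ : 1 < θ

namespace AitSahaliaParams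

variable {Ω : Type*} (p : AitSahaliaParams)

/-- The linear rate `λ = (θ - 1) a₁`. -/
def rate : ℝ := (p.θ - 1) * p.a₁

/-- The nonlinear part `F` of the drift of the transformed equation
`dY = (-λ Y + F(Y)) dt + b (1 - θ) dW` for `Y = X ^ (1 - θ)`. It is meant for `x > 0`. -/
def F (x : ℝ) : ℝ :=
  (p.θ - 1) *
    (p.a₂ * x ^ ((p.γ - p.θ) / (1 - p.θ)) - p.aₘ * x ^ ((p.θ + 1) / (p.θ - 1))
      + p.a₀ * x ^ (p.θ / (p.θ - 1)) + 1 / 2 * p.b ^ 2 * p.θ * x⁻¹)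

/-- The tamed nonlinearity `F / (1 + τ |F|²)`. -/
def tamedF (τ x : ℝ) : ℝ := p.F x / (1 + τ * |p.F x| ^ 2)

/-- One step of the tamed-splitting method from `x` with noise increment `w`. -/
def tamedStep (τ x w : ℝ) : ℝ :=
  Real.exp (-p.rate * τ) * (x + τ * p.tamedF τ x + p.b * (1 - p.θ) * w)

/-- `x'` is a backward Euler step from `x` with noise increment `w`: a solution of the implicit
equation in the state space `(0, ∞)`. -/
def IsBackwardEulerStep (τ x w x' : ℝ) : Prop :=
  0 < x' ∧ x' = x + (p.F x' - p.rate * x') * τ + p.b * (1 - p.θ) * w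

/-- The increment `W (t_{n+1}) - W (t_n)` on the mesh `t_n = n τ`. -/
def increment (W : ℝ≥0 → Ω → ℝ) (τ : ℝ≥0) (n : ℕ) (ω : Ω) : ℝ :=
  W (((n + 1 : ℕ) : ℝ≥0) * τ) ω - W ((n : ℝ≥0) * τ) ω

/-- The value that the tamed-splitting method proposes for the iterate `n + 1`, given the
iterate `Y n`. The backstop is invoked in step `n` exactly if this value is not positive. -/
def proposal (W : ℝ≥0 → Ω → ℝ) (τ : ℝ≥0) (Y : ℕ → Ω → ℝ) (n : ℕ) (ω : Ω) : ℝ :=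
  p.tamedStep τ (Y n ω) (increment W τ n ω)

/-- `Y 0, …, Y N` are iterates of the tamed-splitting method with backward Euler backstop, with
step size `τ`, driven by `W` and started from `y₀`: a positive proposal is accepted, any other one
is replaced by a backward Euler step from the same iterate with the same increment. -/
structure IsBackstoppedSolution [MeasurableSpace Ω] (P : Measure Ω) (W : ℝ≥0 → Ω → ℝ) (τ : ℝ≥0)
    (N : ℕ) (y₀ : ℝ) (Y : ℕ → Ω → ℝ) : Prop where
  initial : ∀ᵐ ω ∂P, Y 0 ω = y₀
  accept : ∀ᵐ ω ∂P, ∀ n < N, 0 < p.proposal W τ Y n ω → Y (n + 1) ω = p.proposal W τ Y n ω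
  backstop : ∀ᵐ ω ∂P, ∀ n < N, p.proposal W τ Y n ω ≤ 0 →
    p.IsBackwardEulerStep τ (Y n ω) (increment W τ n ω) (Y (n + 1) ω)

/-- The event that `Y 0, …, Y N` are all positive, each of `Y 1, …, Y N` already as the
tamed-splitting method proposes it, that is, without any use of the backstop. -/
def positivityEvent (W : ℝ≥0 → Ω → ℝ) (τ : ℝ≥0) (N : ℕ) (Y : ℕ → Ω → ℝ) : Set Ω :=
  {ω | (∀ j ≤ N, 0 < Y j ω) ∧ ∀ n < N, 0 < p.proposal W τ Y n ω}

/-- The event that the backstop is invoked in at least one of the steps `0, …, N - 1`. -/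
def backstopEvent (W : ℝ≥0 → Ω → ℝ) (τ : ℝ≥0) (N : ℕ) (Y : ℕ → Ω → ℝ) : Set Ω :=
  {ω | ∃ n < N, p.proposal W τ Y n ω ≤ 0}

end AitSahaliaParams

end

/-! The function `x - log x` blows up at both ends of `(0, ∞)` and is a Lyapunov function for the
transformed equation. Its generator is bounded above by some `C`: near `0` the repulsion `½ b² θ (θ
- 1) / x` in `F` beats the Itô term of the constant noise `b (1 - θ)`, and on `[1, ∞)` the drift is
bounded above because `-aₘ x ^ ((θ + 1) / (θ - 1))` dominates.

For fixed `K`, the sublevel set of `x - log x` at level `K` lies in a compact part of `(0, ∞)`.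
There `F` is bounded, so the tamed step is a uniformly consistent discretisation, and for small `τ`
it raises the mean of the cut-off Lyapunov function by at most `(C + 1) τ`
(`exists_integral_cutLyapunov_tamedStep_le`). Freezing the tamed chain on exit and applying Markov's
inequality gives `K · P(exit) ≤ y₀ - log y₀ + (C + 1) T`. So `K` is chosen first, from `ε`, and `τ₀`
afterwards, from `K`. Without exit, every proposal is positive and the chain is the backstopped
solution. -/

/-! ### Bounds on the drift and on the generator of `x - log x` -/

/-- A power with a bounded base minus a dominating higher power is bounded above. -/
lemma rpow_mul_sub_le {A a u s : ℝ} (hA : 0 < A) (ha : 0 < a) (hu : 0 ≤ u) (hs : 0 ≤ s) :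
    u ^ s * (A - a * u) ≤ (A / a) ^ s * A := by
  have hus : 0 ≤ u ^ s := Real.rpow_nonneg hu s
  have hAa : 0 < A / a := div_pos hA ha
  rcases le_total u (A / a) with h | h
  · have h1 : u ^ s ≤ (A / a) ^ s := Real.rpow_le_rpow hu h hs
    have h2 : A - a * u ≤ A := by nlinarith [mul_nonneg ha.le hu]
    calc u ^ s * (A - a * u) ≤ u ^ s * A := mul_le_mul_of_nonneg_left h2 hus
      _ ≤ _ := mul_le_mul_of_nonneg_right h1 hA.le
  · have h2 : A - a * u ≤ 0 := by
      rw [div_le_iff₀ ha] at h; linarith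
    have := mul_nonpos_of_nonneg_of_nonpos hus h2
    have h3 : 0 ≤ (A / a) ^ s * A := mul_nonneg (Real.rpow_nonneg hAa.le s) hA.le
    linarith

namespace AitSahaliaParams

variable (p : AitSahaliaParams)

lemma rate_pos : 0 < p.rate := mul_pos (by linarith [p.one_lt_θ]) p.a₁_pos

lemma measurable_F : Measurable p.F := by
  unfold F; fun_prop

lemma continuousOn_F : ContinuousOn p.F (Set.Ioi 0) := by
  have h (e : ℝ) : ContinuousOn (fun x : ℝ => x ^ e) (Set.Ioi 0) := fun x hx =>
    (Real.continuousAt_rpow_const x e (Or.inl (ne_of_gt hx))).continuousWithinAt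
  have hinv : ContinuousOn (fun x : ℝ => x⁻¹) (Set.Ioi 0) :=
    continuousOn_inv₀.mono fun x hx => ne_of_gt hx
  unfold F
  exact continuousOn_const.mul ((((continuousOn_const.mul (h _)).sub
    (continuousOn_const.mul (h _))).add (continuousOn_const.mul (h _))).add
    (continuousOn_const.mul hinv))

/-- On `[1, ∞)` the nonlinearity `F` is bounded above. -/
lemma exists_F_le : ∃ C, ∀ x, 1 ≤ x → p.F x ≤ C := by
  have hθ := p.one_lt_θ
  have hγ := p.one_lt_γ
  have hd : 0 < p.θ - 1 := by linarith
  have hA : 0 < p.a₂ + p.a₀ := add_pos p.a₂_pos p.a₀_pos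
  refine ⟨(p.θ - 1) * (((p.a₂ + p.a₀) / p.aₘ) ^ p.θ * (p.a₂ + p.a₀) + 1 / 2 * p.b ^ 2 * p.θ),
    fun x hx => ?_⟩
  have hx0 : 0 < x := by linarith
  unfold F
  refine mul_le_mul_of_nonneg_left ?_ hd.le
  -- In terms of `u` the two competing powers are `u ^ θ` and `u ^ (θ + 1)`.
  set u := x ^ (1 / (p.θ - 1)) with hu
  have hu0 : 0 < u := Real.rpow_pos_of_pos hx0 _
  have e1 : x ^ ((p.γ - p.θ) / (1 - p.θ)) ≤ x ^ (p.θ / (p.θ - 1)) := by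
    refine Real.rpow_le_rpow_of_exponent_le hx ?_
    rw [← neg_div_neg_eq, neg_sub, neg_sub]
    exact div_le_div_of_nonneg_right (by linarith) hd.le
  have e2 : x ^ (p.θ / (p.θ - 1)) = u ^ p.θ := by
    rw [hu, ← Real.rpow_mul hx0.le]; congr 1; ring
  have e3 : x ^ ((p.θ + 1) / (p.θ - 1)) = u ^ p.θ * u := by
    rw [← Real.rpow_add_one hu0.ne', hu, ← Real.rpow_mul hx0.le]; congr 1; ring
  have e4 : x⁻¹ ≤ 1 := inv_le_one_of_one_le₀ hx
  have h5 := rpow_mul_sub_le hA p.aₘ_pos hu0.le (by linarith : (0 : ℝ) ≤ p.θ)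
  rw [e2] at e1
  rw [e2, e3]
  have h6 := mul_le_mul_of_nonneg_left e1 p.a₂_pos.le
  have h7 : 1 / 2 * p.b ^ 2 * p.θ * x⁻¹ ≤ 1 / 2 * p.b ^ 2 * p.θ * 1 :=
    mul_le_mul_of_nonneg_left e4 (by positivity)
  linarith

/-- On `(0, 1]` the nonlinearity `F` dominates a Bessel-type drift. -/
lemma le_F {x : ℝ} (hx : 0 < x) (hx1 : x ≤ 1) :
    (p.θ - 1) * (1 / 2 * p.b ^ 2 * p.θ * x⁻¹ - p.aₘ) ≤ p.F x := by
  have hd : 0 < p.θ - 1 := by linarith [p.one_lt_θ]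
  unfold F
  refine mul_le_mul_of_nonneg_left ?_ hd.le
  have h1 : x ^ ((p.θ + 1) / (p.θ - 1)) ≤ 1 :=
    Real.rpow_le_one hx.le hx1 (div_nonneg (by linarith) hd.le)
  have h2 := mul_pos p.a₂_pos (Real.rpow_pos_of_pos hx ((p.γ - p.θ) / (1 - p.θ)))
  have h3 := mul_pos p.a₀_pos (Real.rpow_pos_of_pos hx (p.θ / (p.θ - 1)))
  have h4 := mul_le_mul_of_nonneg_left h1 p.aₘ_pos.le
  linarith

/-- The generator of the transformed equation, applied to `x - log x`, is bounded above. -/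
lemma exists_generator_le : ∃ C, 0 ≤ C ∧ ∀ x, 0 < x →
    (1 - 1 / x) * (p.F x - p.rate * x) + (p.b * (1 - p.θ)) ^ 2 / (2 * x ^ 2) ≤ C := by
  obtain ⟨C₁, hC₁⟩ := p.exists_F_le
  have hθ := p.one_lt_θ
  have hd : 0 < p.θ - 1 := by linarith
  have hb := p.b_pos
  have hl := p.rate_pos
  set κ := (p.θ - 1) * (1 / 2 * p.b ^ 2 * p.θ) with hκ
  set A := (p.θ - 1) * p.aₘ with hA
  set σ2 := (p.b * (1 - p.θ)) ^ 2 with hσ2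
  have hA0 : 0 < A := mul_pos hd p.aₘ_pos
  -- `-c` is the coefficient of `x⁻²` in the bound near `0`; `c > 0` because `θ (θ - 1) > (θ - 1)²`.
  set c := κ - σ2 / 2 with hc
  have hc0 : 0 < c := by
    have : c = 1 / 2 * p.b ^ 2 * (p.θ - 1) := by rw [hc, hκ, hσ2]; ring
    rw [this]; positivity
  have hσ0 : 0 ≤ σ2 := sq_nonneg _
  refine ⟨|C₁| + σ2 + ((κ + A) ^ 2 / (4 * c) + p.rate), by positivity, fun x hx => ?_⟩
  have hpos : 0 ≤ (κ + A) ^ 2 / (4 * c) := by positivity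
  rcases le_total 1 x with h1 | h1
  · have e1 : 0 ≤ 1 - 1 / x := by
      rw [sub_nonneg, div_le_one hx]; exact h1
    have e2 : 1 - 1 / x ≤ 1 := by
      have : 0 < 1 / x := by positivity
      linarith
    have e3 : p.F x - p.rate * x ≤ |C₁| := by
      have := hC₁ x h1
      have := le_abs_self C₁
      have : 0 < p.rate * x := by positivity
      linarith
    have e4 : σ2 / (2 * x ^ 2) ≤ σ2 := div_le_self hσ0 (by nlinarith)
    have e5 : (1 - 1 / x) * (p.F x - p.rate * x) ≤ 1 * |C₁| := by
      calc _ ≤ (1 - 1 / x) * |C₁| := mul_le_mul_of_nonneg_left e3 e1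
        _ ≤ _ := mul_le_mul_of_nonneg_right e2 (abs_nonneg _)
    linarith
  · have hF := p.le_F hx h1
    set s := x⁻¹ with hs
    have hs1 : 1 ≤ s := (one_le_inv₀ hx).2 h1
    have hxs : x * s = 1 := mul_inv_cancel₀ hx.ne'
    have e1 : σ2 / (2 * x ^ 2) = σ2 / 2 * s ^ 2 := by
      rw [hs]; field_simp
    have e2 : (1 - 1 / x) = -(s - 1) := by rw [one_div]; ring
    have hF' : κ * s - A ≤ p.F x := by
      have : κ * s - A = (p.θ - 1) * (1 / 2 * p.b ^ 2 * p.θ * s - p.aₘ) := by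
        rw [hκ, hA]; ring
      linarith
    have e3 : (s - 1) * (κ * s - A) ≤ (s - 1) * p.F x :=
      mul_le_mul_of_nonneg_left hF' (by linarith)
    have e4 : (κ + A) * s - c * s ^ 2 ≤ (κ + A) ^ 2 / (4 * c) := by
      rw [le_div_iff₀ (by positivity)]
      nlinarith [sq_nonneg (κ + A - 2 * c * s)]
    have e5 : (s - 1) * (p.rate * x) ≤ p.rate := by
      have : (s - 1) * (p.rate * x) = p.rate - p.rate * x := by
        linear_combination p.rate * hxs
      nlinarith [mul_pos hl hx]
    rw [e1, e2]
    have e6 : c * s ^ 2 = κ * s ^ 2 - σ2 / 2 * s ^ 2 := by rw [hc]; ring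
    nlinarith [abs_nonneg C₁]

end AitSahaliaParams

/-! ### The cut-off Lyapunov function and its Taylor bounds -/

/-- The Lyapunov function `x - log x`, cut off at the level `K` and set to `K` outside its
sublevel set in `(0, ∞)`. -/
noncomputable def cutLyapunov (K x : ℝ) : ℝ :=
  open Classical in if 0 < x ∧ x - Real.log x < K then x - Real.log x else K

/-- The sublevel set of `x - log x` in `(0, ∞)`. -/
def lyapunovSublevel (K : ℝ) : Set ℝ := {x | 0 < x ∧ x - Real.log x < K}

lemma one_le_sub_log {x : ℝ} (hx : 0 < x) : 1 ≤ x - Real.log x := by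
  linarith [Real.log_le_sub_one_of_pos hx]

lemma measurableSet_lyapunovSublevel (K : ℝ) : MeasurableSet (lyapunovSublevel K) :=
  measurableSet_Ioi.inter
    (measurableSet_lt (measurable_id.sub Real.measurable_log) measurable_const)

lemma measurable_cutLyapunov (K : ℝ) : Measurable (cutLyapunov K) :=
  Measurable.ite (measurableSet_lyapunovSublevel K) (measurable_id.sub Real.measurable_log)
    measurable_const

lemma cutLyapunov_of_mem {K x : ℝ} (hx : x ∈ lyapunovSublevel K) :
    cutLyapunov K x = x - Real.log x := if_pos hx

lemma cutLyapunov_of_notMem {K x : ℝ} (hx : x ∉ lyapunovSublevel K) :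
    cutLyapunov K x = K := if_neg hx

lemma cutLyapunov_le (K x : ℝ) : cutLyapunov K x ≤ K := by
  by_cases h : x ∈ lyapunovSublevel K
  · rw [cutLyapunov_of_mem h]; exact h.2.le
  · rw [cutLyapunov_of_notMem h]

lemma cutLyapunov_nonneg {K : ℝ} (hK : 0 ≤ K) (x : ℝ) : 0 ≤ cutLyapunov K x := by
  by_cases h : x ∈ lyapunovSublevel K
  · rw [cutLyapunov_of_mem h]; linarith [one_le_sub_log h.1]
  · rwa [cutLyapunov_of_notMem h]

lemma cutLyapunov_le_sub_log (K : ℝ) {x : ℝ} (hx : 0 < x) :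
    cutLyapunov K x ≤ x - Real.log x := by
  by_cases h : x ∈ lyapunovSublevel K
  · rw [cutLyapunov_of_mem h]
  · rw [cutLyapunov_of_notMem h]
    by_contra! h'
    exact h ⟨hx, h'⟩

/-- Together with the upper bound `2 * K`, this confines the sublevel set to a compact interval in
`(0, ∞)`. -/
lemma exp_neg_lt_of_mem_lyapunovSublevel {K x : ℝ} (hx : x ∈ lyapunovSublevel K) :
    Real.exp (-K) < x := by
  rw [← Real.lt_log_iff_exp_lt hx.1]
  linarith [hx.1, hx.2]

/-- Follows from `log x ≤ x / 2`. -/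
lemma lt_of_mem_lyapunovSublevel {K x : ℝ} (hx : x ∈ lyapunovSublevel K) : x < 2 * K := by
  have h1 := Real.log_le_sub_one_of_pos (half_pos hx.1)
  rw [Real.log_div hx.1.ne' two_ne_zero] at h1
  have h2 := Real.log_le_sub_one_of_pos (zero_lt_two (α := ℝ))
  linarith [hx.2]

/-- Second-order Taylor bound for `x - log x`. -/
lemma sub_log_add_le {x h : ℝ} (hx : 0 < x) (hh : |h| ≤ x / 2) :
    (x + h) - Real.log (x + h) ≤
      (x - Real.log x) + (1 - 1 / x) * h + h ^ 2 / (2 * x ^ 2) + 2 / x ^ 3 * |h| ^ 3 := by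
  set u := h / x with hu
  have hux : h = x * u := by rw [hu]; field_simp
  have hu2 : |u| ≤ 1 / 2 := by
    rw [hu, abs_div, abs_of_pos hx, div_le_iff₀ hx]; linarith
  have h1 := Real.abs_log_sub_add_sum_range_le (x := -u) (by rw [abs_neg]; linarith) 2
  rw [abs_neg] at h1
  simp only [Finset.sum_range_succ, Finset.sum_range_zero] at h1
  have h2 : |u| ^ (2 + 1) / (1 - |u|) ≤ 2 * |u| ^ 3 := by
    rw [div_le_iff₀ (by linarith)]
    have := mul_nonneg (pow_nonneg (abs_nonneg u) 3) (by linarith : 0 ≤ 1 - 2 * |u|)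
    norm_num
    linarith
  have h3 := (abs_le.1 (h1.trans h2)).1
  have h4 : Real.log (x + h) = Real.log x + Real.log (1 - -u) := by
    rw [← Real.log_mul hx.ne' (by linarith [(abs_le.1 hu2).1]), hux]; congr 1; ring
  rw [h4, sub_neg_eq_add]
  have e1 : (1 - 1 / x) * h = h - u := by rw [hu]; ring
  have e2 : h ^ 2 / (2 * x ^ 2) = u ^ 2 / 2 := by rw [hu]; field_simp
  have e3 : 2 / x ^ 3 * |h| ^ 3 = 2 * |u| ^ 3 := by
    rw [hu, abs_div, abs_of_pos hx]; field_simp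
  rw [e1, e2, e3]
  norm_num at h3
  linarith

/-- Global second-order Taylor bound for the cut-off Lyapunov function. -/
lemma cutLyapunov_add_le {K r x : ℝ} (hr : 0 < r) (hr1 : r ≤ 1) (hrx : r ≤ x) (hK : 0 ≤ K) (h : ℝ) :
    cutLyapunov K (x + h) ≤ (x - Real.log x) + (1 - 1 / x) * h + h ^ 2 / (2 * x ^ 2)
      + (4 + 8 * K) / r ^ 3 * |h| ^ 3 := by
  have hx : 0 < x := hr.trans_le hrx
  have hh3 : 0 ≤ |h| ^ 3 := by positivity
  rcases le_or_gt |h| (x / 2) with hh | hh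
  · have h1 := sub_log_add_le hx hh
    have h2 := cutLyapunov_le_sub_log K (x := x + h) (by linarith [(abs_le.1 hh).1])
    have h3 : 2 / x ^ 3 * |h| ^ 3 ≤ (4 + 8 * K) / r ^ 3 * |h| ^ 3 := by
      refine mul_le_mul_of_nonneg_right ?_ hh3
      exact div_le_div₀ (by positivity) (by linarith) (by positivity)
        (pow_le_pow_left₀ hr.le hrx 3)
    linarith
  -- Here `x + h` may have left `(0, ∞)`, but the cut-off value is at most `K`. As `|h| / r ≥ 1 /
  -- 2`, the cubic term pays for everything: its part `8 * K` covers `K`, its part `4` the linear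
  -- term.
  · have h1 := cutLyapunov_le K (x + h)
    have h2 := one_le_sub_log hx
    have h3 : 0 ≤ h ^ 2 / (2 * x ^ 2) := by positivity
    set v := |h| / r with hv
    have hv2 : 1 / 2 ≤ v := by rw [hv, le_div_iff₀ hr]; linarith
    have h4 : |1 - 1 / x| ≤ 1 / r := by
      have h5 : 1 / x ≤ 1 / r := one_div_le_one_div_of_le hr hrx
      have h6 : 1 ≤ 1 / r := by rw [le_div_iff₀ hr]; linarith
      have h7 : 0 < 1 / x := by positivity
      rw [abs_le]; constructor <;> linarith
    have h5 : -v ≤ (1 - 1 / x) * h := by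
      have h6 : |(1 - 1 / x) * h| ≤ v := by
        rw [abs_mul, hv]
        calc _ ≤ 1 / r * |h| := mul_le_mul_of_nonneg_right h4 (abs_nonneg _)
          _ = _ := by ring
      exact (abs_le.1 h6).1
    have h6 : (4 + 8 * K) / r ^ 3 * |h| ^ 3 = (4 + 8 * K) * v ^ 3 := by
      rw [hv]; field_simp
    have h7 : 1 / 4 ≤ v ^ 2 := by nlinarith
    have h8 : 1 / 8 ≤ v ^ 3 := by nlinarith
    have h9 : v ≤ 4 * v ^ 3 := by nlinarith
    rw [h6]
    nlinarith

/-! ### Gaussian moments and the expected Taylor bound -/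

lemma integrable_pow_gaussianReal (μ : ℝ) (v : ℝ≥0) (n : ℕ) :
    Integrable (fun w : ℝ => |w| ^ n) (gaussianReal μ v) := by
  simpa using (memLp_id_gaussianReal (μ := μ) (v := v) n).integrable_norm_pow'

lemma integral_sq_gaussianReal (v : ℝ≥0) : ∫ w, w ^ 2 ∂gaussianReal 0 v = v := by
  have h := variance_fun_id_gaussianReal (μ := 0) (v := v)
  rw [variance_eq_integral measurable_id'.aemeasurable] at h
  simpa using h

/-- Scaling by `√v`; with `n = 3` it makes the noise remainder of order `τ ^ (3 / 2)`. -/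
lemma integral_abs_pow_gaussianReal (v : ℝ≥0) (n : ℕ) :
    ∫ w, |w| ^ n ∂gaussianReal 0 v = √(v : ℝ) ^ n * ∫ w, |w| ^ n ∂gaussianReal 0 1 := by
  have h := gaussianReal_map_const_mul (μ := 0) (v := 1) √(v : ℝ)
  have h2 : NNReal.mk (√(v : ℝ) ^ 2) (sq_nonneg _) * 1 = v := by
    ext; simp
  rw [h2, mul_zero] at h
  rw [← h, integral_map (by fun_prop) (by fun_prop), ← integral_const_mul]
  refine integral_congr_ae (Filter.Eventually.of_forall fun w => ?_)
  simp only [abs_mul, mul_pow, abs_of_nonneg (Real.sqrt_nonneg _)]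

/-- Integrated form of the Taylor bound for an affine function of a centred Gaussian variable. -/
lemma integral_cutLyapunov_gaussianReal_le {K r x : ℝ} (hr : 0 < r) (hr1 : r ≤ 1) (hrx : r ≤ x)
    (hK : 0 ≤ K) (A B : ℝ) (v : ℝ≥0) :
    ∫ w, cutLyapunov K (x + (A + B * w)) ∂gaussianReal 0 v ≤
      (x - Real.log x) + (1 - 1 / x) * A + (A ^ 2 + B ^ 2 * v) / (2 * x ^ 2)
      + (4 + 8 * K) / r ^ 3 * (4 * |A| ^ 3 +
        4 * |B| ^ 3 * (√(v : ℝ) ^ 3 * ∫ w, |w| ^ 3 ∂gaussianReal 0 1)) := by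
  set G := gaussianReal 0 v
  set c := (4 + 8 * K) / r ^ 3 with hc
  have hc0 : 0 ≤ c := by positivity
  have i1 : Integrable (fun w : ℝ => w) G := by
    exact (memLp_id_gaussianReal (μ := 0) (v := v) 1).integrable le_rfl
  have i2 : Integrable (fun w : ℝ => w ^ 2) G := by
    simpa using integrable_pow_gaussianReal 0 v 2
  have i3 := integrable_pow_gaussianReal 0 v 3
  set k0 := (x - Real.log x) + (1 - 1 / x) * A + A ^ 2 / (2 * x ^ 2) + c * (4 * |A| ^ 3) with hk0
  -- This coefficient drops out on integration, as the Gaussian is centred.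
  set k1 := (1 - 1 / x) * B + A * B / x ^ 2 with hk1
  set k2 := B ^ 2 / (2 * x ^ 2) with hk2
  set k3 := c * (4 * |B| ^ 3) with hk3
  have hint : Integrable (fun w => cutLyapunov K (x + (A + B * w))) G := by
    refine Integrable.of_bound
      ((measurable_cutLyapunov K).comp (by fun_prop)).aestronglyMeasurable K ?_
    refine Filter.Eventually.of_forall fun w => ?_
    rw [Real.norm_of_nonneg (cutLyapunov_nonneg hK _)]
    exact cutLyapunov_le K _
  have hle (w : ℝ) : cutLyapunov K (x + (A + B * w)) ≤
      k0 + k1 * w + k2 * w ^ 2 + k3 * |w| ^ 3 := by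
    refine (cutLyapunov_add_le hr hr1 hrx hK (A + B * w)).trans ?_
    have h1 : |A + B * w| ^ 3 ≤ 4 * (|A| ^ 3 + (|B| * |w|) ^ 3) := by
      have h2 : |A + B * w| ≤ |A| + |B| * |w| := by
        rw [← abs_mul]; exact abs_add_le _ _
      have h3 := add_pow_le (abs_nonneg A) (mul_nonneg (abs_nonneg B) (abs_nonneg w)) 3
      norm_num at h3
      exact (pow_le_pow_left₀ (abs_nonneg _) h2 3).trans h3
    have h4 := mul_le_mul_of_nonneg_left h1 hc0
    refine (add_le_add_right h4 _).trans (le_of_eq ?_)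
    rw [hk0, hk1, hk2, hk3]
    have : x ≠ 0 := (hr.trans_le hrx).ne'
    field_simp
    ring
  have j1 : Integrable (fun w : ℝ => k0 + k1 * w) G := (integrable_const k0).add (i1.const_mul k1)
  have j2 : Integrable (fun w : ℝ => k0 + k1 * w + k2 * w ^ 2) G := j1.add (i2.const_mul k2)
  have j3 : Integrable (fun w : ℝ => k0 + k1 * w + k2 * w ^ 2 + k3 * |w| ^ 3) G :=
    j2.add (i3.const_mul k3)
  refine (integral_mono hint j3 hle).trans (le_of_eq ?_)
  rw [integral_add j2 (i3.const_mul k3), integral_add j1 (i2.const_mul k2),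
    integral_add (integrable_const k0) (i1.const_mul k1), integral_const_mul, integral_const_mul,
    integral_const_mul, integral_const, integral_id_gaussianReal, integral_sq_gaussianReal,
    integral_abs_pow_gaussianReal]
  simp only [probReal_univ, one_smul]
  rw [hk0, hk2, hk3]
  ring

/-- The Taylor terms of one step of size `q ^ 2`: the leading order is the generator, and the rest
is absorbed if `q` is small. -/
lemma taylor_terms_le {r x q g S Q c m σ e A C : ℝ} (hr0 : 0 < r) (hr1 : r ≤ 1) (hrx : r ≤ x)
    (hq0 : 0 ≤ q) (hq1 : q ≤ 1) (hS0 : 0 ≤ S) (hQ0 : 0 ≤ Q) (hc0 : 0 ≤ c) (hm0 : 0 ≤ m)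
    (he0 : 0 ≤ e) (he1 : e ≤ 1) (hAd : |A - q ^ 2 * g| ≤ Q * q ^ 4) (hA1 : |A| ≤ S * q ^ 2)
    (hC : (1 - 1 / x) * g + σ ^ 2 / (2 * x ^ 2) ≤ C)
    (hqD : q * (1 / r * Q + S ^ 2 / (2 * r ^ 2) + c * (4 * S ^ 3 + 4 * |σ| ^ 3 * m)) ≤ 1) :
    (1 - 1 / x) * A + (A ^ 2 + (e * σ) ^ 2 * q ^ 2) / (2 * x ^ 2)
      + c * (4 * |A| ^ 3 + 4 * |e * σ| ^ 3 * (q ^ 3 * m)) ≤ (C + 1) * q ^ 2 := by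
  have hx0 : 0 < x := hr0.trans_le hrx
  have hinv : |1 - 1 / x| ≤ 1 / r := by
    have h5 : 1 / x ≤ 1 / r := one_div_le_one_div_of_le hr0 hrx
    have h6 : 1 ≤ 1 / r := by rw [le_div_iff₀ hr0]; linarith
    have h7 : 0 < 1 / x := by positivity
    rw [abs_le]; constructor <;> linarith
  -- With `q = √τ`, every error is brought down to order `q ^ 3`; `hqD` then bounds their sum by `q
  -- ^ 2`, the extra `1` in `C + 1`.
  have hq4 : q ^ 4 ≤ q ^ 3 := pow_le_pow_of_le_one hq0 hq1 (by norm_num)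
  have hq6 : q ^ 6 ≤ q ^ 3 := pow_le_pow_of_le_one hq0 hq1 (by norm_num)
  have t1 : (1 - 1 / x) * A ≤ (1 - 1 / x) * (q ^ 2 * g) + 1 / r * Q * q ^ 3 := by
    have h1 : (1 - 1 / x) * (A - q ^ 2 * g) ≤ 1 / r * (Q * q ^ 4) := by
      refine (le_abs_self _).trans ?_
      rw [abs_mul]
      exact mul_le_mul hinv hAd (abs_nonneg _) (by positivity)
    have h2 : 1 / r * (Q * q ^ 4) ≤ 1 / r * (Q * q ^ 3) := by gcongr
    linarith
  have t2 : (A ^ 2 + (e * σ) ^ 2 * q ^ 2) / (2 * x ^ 2) ≤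
      S ^ 2 / (2 * r ^ 2) * q ^ 3 + q ^ 2 * (σ ^ 2 / (2 * x ^ 2)) := by
    have h1 : A ^ 2 ≤ S ^ 2 * q ^ 3 := by
      rw [← sq_abs A]
      calc |A| ^ 2 ≤ (S * q ^ 2) ^ 2 := pow_le_pow_left₀ (abs_nonneg _) hA1 2
        _ = S ^ 2 * q ^ 4 := by ring
        _ ≤ _ := mul_le_mul_of_nonneg_left hq4 (by positivity)
    have h2 : (e * σ) ^ 2 ≤ σ ^ 2 := by
      rw [mul_pow]
      exact mul_le_of_le_one_left (sq_nonneg σ) (pow_le_one₀ he0 he1)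
    rw [add_div]
    refine add_le_add ?_ ?_
    · calc A ^ 2 / (2 * x ^ 2) ≤ S ^ 2 * q ^ 3 / (2 * r ^ 2) := by gcongr
        _ = _ := by ring
    · calc (e * σ) ^ 2 * q ^ 2 / (2 * x ^ 2) ≤ σ ^ 2 * q ^ 2 / (2 * x ^ 2) := by gcongr
        _ = _ := by ring
  have t3 : 4 * |A| ^ 3 + 4 * |e * σ| ^ 3 * (q ^ 3 * m) ≤
      (4 * S ^ 3 + 4 * |σ| ^ 3 * m) * q ^ 3 := by
    have h1 : |A| ^ 3 ≤ S ^ 3 * q ^ 3 := by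
      calc |A| ^ 3 ≤ (S * q ^ 2) ^ 3 := pow_le_pow_left₀ (abs_nonneg _) hA1 3
        _ = S ^ 3 * q ^ 6 := by ring
        _ ≤ _ := mul_le_mul_of_nonneg_left hq6 (by positivity)
    have h2 : |e * σ| ≤ |σ| := by
      rw [abs_mul, abs_of_nonneg he0]
      exact mul_le_of_le_one_left (abs_nonneg _) he1
    have h3 : |e * σ| ^ 3 * (q ^ 3 * m) ≤ |σ| ^ 3 * (q ^ 3 * m) := by gcongr
    linarith
  have t4 := mul_le_mul_of_nonneg_left t3 hc0
  have t5 := mul_le_mul_of_nonneg_left hC (sq_nonneg q)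
  have t6 := mul_le_mul_of_nonneg_right hqD (sq_nonneg q)
  linarith

/-! ### Consistency of the tamed step and its drift condition -/

namespace AitSahaliaParams

variable (p : AitSahaliaParams)

lemma abs_tamedF_le {τ : ℝ} (hτ : 0 ≤ τ) (x : ℝ) : |p.tamedF τ x| ≤ |p.F x| := by
  unfold tamedF
  have h : 1 ≤ 1 + τ * |p.F x| ^ 2 := by
    have : 0 ≤ τ * |p.F x| ^ 2 := by positivity
    linarith
  rw [abs_div, abs_of_pos (by linarith : 0 < 1 + τ * |p.F x| ^ 2)]
  exact div_le_self (abs_nonneg _) h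

lemma abs_tamedF_sub_le {τ : ℝ} (hτ : 0 ≤ τ) (x : ℝ) :
    |p.tamedF τ x - p.F x| ≤ τ * |p.F x| ^ 3 := by
  have h : 1 ≤ 1 + τ * |p.F x| ^ 2 := by
    have : 0 ≤ τ * |p.F x| ^ 2 := by positivity
    linarith
  have e : p.tamedF τ x - p.F x = -(p.tamedF τ x * (τ * |p.F x| ^ 2)) := by
    unfold tamedF
    field_simp
    ring
  rw [e, abs_neg, abs_mul, abs_of_nonneg (by positivity : 0 ≤ τ * |p.F x| ^ 2)]
  calc _ ≤ |p.F x| * (τ * |p.F x| ^ 2) :=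
        mul_le_mul_of_nonneg_right (p.abs_tamedF_le hτ x) (by positivity)
    _ = _ := by ring

/-- The mean increment of the tamed step is close to the drift. -/
lemma abs_mean_increment_sub_le {τ x R M : ℝ} (hτ : 0 ≤ τ) (hτl : p.rate * τ ≤ 1) (hx : 0 < x)
    (hxR : x ≤ R) (hM : |p.F x| ≤ M) :
    |Real.exp (-p.rate * τ) * (x + τ * p.tamedF τ x) - x - τ * (p.F x - p.rate * x)| ≤
      (p.rate ^ 2 * R + p.rate * M + M ^ 3) * τ ^ 2 := by
  have hl := p.rate_pos
  set e := Real.exp (-p.rate * τ)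
  set f := p.tamedF τ x
  have hlt : 0 ≤ p.rate * τ := by positivity
  have h1 : |e - 1 - -p.rate * τ| ≤ p.rate ^ 2 * τ ^ 2 := by
    have := Real.abs_exp_sub_one_sub_id_le (x := -p.rate * τ)
      (by rw [neg_mul, abs_neg, abs_of_nonneg hlt]; exact hτl)
    calc _ ≤ _ := this
      _ = _ := by ring
  have h2 : |e - 1| ≤ p.rate * τ := by
    have h3 : e ≤ 1 := Real.exp_le_one_iff.2 (by linarith)
    have h4 := Real.add_one_le_exp (-p.rate * τ)
    rw [abs_le]; constructor <;> linarith
  have hf : |f| ≤ M := (p.abs_tamedF_le hτ x).trans hM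
  have hfF : |f - p.F x| ≤ τ * M ^ 3 := (p.abs_tamedF_sub_le hτ x).trans
    (mul_le_mul_of_nonneg_left (pow_le_pow_left₀ (abs_nonneg _) hM 3) hτ)
  -- Three errors: linearising the exponential, its interaction with the nonlinearity, and taming.
  have hE : e * (x + τ * f) - x - τ * (p.F x - p.rate * x) =
      (e - 1 - -p.rate * τ) * x + (e - 1) * (τ * f) + τ * (f - p.F x) := by ring
  rw [hE]
  refine (abs_add_three _ _ _).trans ?_
  rw [abs_mul, abs_mul, abs_mul, abs_mul, abs_of_pos hx, abs_of_nonneg hτ]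
  have b1 : |e - 1 - -p.rate * τ| * x ≤ p.rate ^ 2 * τ ^ 2 * R :=
    mul_le_mul h1 hxR hx.le (by positivity)
  have b2 : |e - 1| * (τ * |f|) ≤ p.rate * τ * (τ * M) :=
    mul_le_mul h2 (mul_le_mul_of_nonneg_left hf hτ) (by positivity) hlt
  have b3 : τ * |f - p.F x| ≤ τ * (τ * M ^ 3) := mul_le_mul_of_nonneg_left hfF hτ
  nlinarith

lemma exists_abs_F_le_of_mem_lyapunovSublevel (K : ℝ) :
    ∃ M, 0 ≤ M ∧ ∀ x ∈ lyapunovSublevel K, |p.F x| ≤ M := by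
  obtain ⟨M, hM⟩ := (isCompact_Icc (a := Real.exp (-K)) (b := 2 * K)).exists_bound_of_continuousOn
    (p.continuousOn_F.mono fun x hx => (Real.exp_pos _).trans_le hx.1)
  exact ⟨|M|, abs_nonneg M, fun x hx => (hM x ⟨(exp_neg_lt_of_mem_lyapunovSublevel hx).le,
    (lt_of_mem_lyapunovSublevel hx).le⟩).trans (le_abs_self M)⟩

/-- The Lyapunov drift condition for the tamed step on a sublevel set, for small step sizes. -/
lemma exists_integral_cutLyapunov_tamedStep_le {C : ℝ}
    (hC : ∀ x, 0 < x →
      (1 - 1 / x) * (p.F x - p.rate * x) + (p.b * (1 - p.θ)) ^ 2 / (2 * x ^ 2) ≤ C)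
    {K : ℝ} (hK : 0 < K) :
    ∃ τ₀ : ℝ≥0, 0 < τ₀ ∧ ∀ τ : ℝ≥0, τ ≤ τ₀ → ∀ x ∈ lyapunovSublevel K,
      ∫ w, cutLyapunov K (p.tamedStep τ x w) ∂gaussianReal 0 τ ≤ cutLyapunov K x + (C + 1) * τ := by
  obtain ⟨M, hM0, hM⟩ := p.exists_abs_F_le_of_mem_lyapunovSublevel K
  have hl := p.rate_pos
  obtain ⟨r, hr⟩ : ∃ r, r = Real.exp (-K) := ⟨_, rfl⟩
  obtain ⟨m, hm⟩ : ∃ m, m = ∫ w, |w| ^ 3 ∂gaussianReal 0 1 := ⟨_, rfl⟩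
  have hm0 : 0 ≤ m := hm ▸ integral_nonneg fun w => by positivity
  have hr0 : 0 < r := hr ▸ Real.exp_pos _
  have hr1 : r ≤ 1 := hr ▸ Real.exp_le_one_iff.2 (by linarith)
  -- `Q`, `S`, `c` and `D` depend only on `K` and the parameters, so the step size bound is uniform
  -- in `x`.
  obtain ⟨Q, hQ⟩ : ∃ Q, Q = p.rate ^ 2 * (2 * K) + p.rate * M + M ^ 3 := ⟨_, rfl⟩
  have hQ0 : 0 ≤ Q := by rw [hQ]; positivity
  obtain ⟨S, hS⟩ : ∃ S, S = Q + (M + p.rate * (2 * K)) := ⟨_, rfl⟩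
  have hS0 : 0 ≤ S := by rw [hS]; positivity
  obtain ⟨c, hc⟩ : ∃ c, c = (4 + 8 * K) / r ^ 3 := ⟨_, rfl⟩
  have hc0 : 0 ≤ c := by rw [hc]; positivity
  obtain ⟨D, hD⟩ : ∃ D, D = 1 / r * Q + S ^ 2 / (2 * r ^ 2)
    + c * (4 * S ^ 3 + 4 * |p.b * (1 - p.θ)| ^ 3 * m) := ⟨_, rfl⟩
  have hD0 : 0 ≤ D := by rw [hD]; positivity
  -- The three bounds give `√τ ≤ 1`, the range of the exponential estimate, and `√τ * D ≤ 1`.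
  obtain ⟨t, ht⟩ : ∃ t, t = min (min 1 (1 / p.rate)) (1 / (D + 1) ^ 2) := ⟨_, rfl⟩
  have ht0 : 0 < t := by rw [ht]; positivity
  refine ⟨⟨t, ht0.le⟩, ht0, fun τ hτ x hx => ?_⟩
  have hτt : (τ : ℝ) ≤ t := hτ
  rw [ht] at hτt
  have hτ0 : (0 : ℝ) ≤ τ := τ.2
  have hτ1 : (τ : ℝ) ≤ 1 := hτt.trans ((min_le_left _ _).trans (min_le_left _ _))
  have hτl : p.rate * τ ≤ 1 := by
    have : (τ : ℝ) ≤ 1 / p.rate := hτt.trans ((min_le_left _ _).trans (min_le_right _ _))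
    rw [le_div_iff₀ hl] at this; linarith
  obtain ⟨q, hq⟩ : ∃ q, q = √(τ : ℝ) := ⟨_, rfl⟩
  have hq0 : 0 ≤ q := hq ▸ Real.sqrt_nonneg _
  have hqq : q ^ 2 = τ := hq ▸ Real.sq_sqrt hτ0
  have hq1 : q ≤ 1 := hq ▸ Real.sqrt_le_one.2 hτ1
  have hqD : q * D ≤ 1 := by
    have h1 : q ≤ 1 / (D + 1) := by
      rw [hq]
      refine Real.sqrt_le_iff.2 ⟨by positivity, ?_⟩
      rw [div_pow, one_pow]
      exact hτt.trans (min_le_right _ _)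
    rw [le_div_iff₀ (by positivity)] at h1
    linarith
  have hrx : r ≤ x := hr ▸ (exp_neg_lt_of_mem_lyapunovSublevel hx).le
  have hxR := (lt_of_mem_lyapunovSublevel hx).le
  have hx0 := hx.1
  obtain ⟨e, he⟩ : ∃ e, e = Real.exp (-p.rate * τ) := ⟨_, rfl⟩
  have he0 : 0 < e := he ▸ Real.exp_pos _
  have he1 : e ≤ 1 := he ▸ Real.exp_le_one_iff.2 (by linarith [mul_nonneg hl.le hτ0])
  obtain ⟨A, hA⟩ : ∃ A, A = e * (x + τ * p.tamedF τ x) - x := ⟨_, rfl⟩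
  have hAd : |A - τ * (p.F x - p.rate * x)| ≤ Q * (τ : ℝ) ^ 2 := by
    rw [hA, he, hQ]
    exact p.abs_mean_increment_sub_le hτ0 hτl hx0 hxR (hM x hx)
  have hFl : |p.F x - p.rate * x| ≤ M + p.rate * (2 * K) := by
    refine (abs_sub _ _).trans (add_le_add (hM x hx) ?_)
    rw [abs_of_pos (by positivity)]
    exact mul_le_mul_of_nonneg_left hxR hl.le
  have hA1 : |A| ≤ S * τ := by
    have h1 : |A| ≤ |A - τ * (p.F x - p.rate * x)| + |τ * (p.F x - p.rate * x)| := by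
      have := abs_add_le (A - τ * (p.F x - p.rate * x)) (τ * (p.F x - p.rate * x))
      rwa [sub_add_cancel] at this
    rw [abs_mul, abs_of_nonneg hτ0] at h1
    have h2 := mul_le_mul_of_nonneg_left hFl hτ0
    have h3 : Q * (τ : ℝ) ^ 2 ≤ Q * τ := mul_le_mul_of_nonneg_left (by nlinarith) hQ0
    rw [hS]; linarith
  have hstep (w : ℝ) : p.tamedStep τ x w = x + (A + e * (p.b * (1 - p.θ)) * w) := by
    rw [tamedStep, hA, he]; ring
  simp only [hstep]
  have key := taylor_terms_le hr0 hr1 hrx hq0 hq1 hS0 hQ0 hc0 hm0 he0.le he1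
    (A := A) (g := p.F x - p.rate * x) (σ := p.b * (1 - p.θ))
    (by rw [show q ^ 4 = (q ^ 2) ^ 2 by ring, hqq]; exact hAd) (by rw [hqq]; exact hA1) (hC x hx0)
    (hD ▸ hqD)
  have hgauss := integral_cutLyapunov_gaussianReal_le hr0 hr1 hrx hK.le A
    (e * (p.b * (1 - p.θ))) τ
  rw [← hm, ← hq, ← hc] at hgauss
  rw [hqq] at key
  rw [cutLyapunov_of_mem hx]
  linarith

end AitSahaliaParams

/-! ### Frozen chains with independent inputs -/

/-- The chain `x ↦ G x w` driven by the inputs `ξ`, frozen once it has left `D`. -/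
noncomputable def frozenChain {Ω : Type*} (D : Set ℝ) (G : ℝ → ℝ → ℝ) (y₀ : ℝ)
    (ξ : ℕ → Ω → ℝ) : ℕ → Ω → ℝ
  | 0, _ => y₀
  | n + 1, ω => open Classical in
      if frozenChain D G y₀ ξ n ω ∈ D then G (frozenChain D G y₀ ξ n ω) (ξ n ω)
      else frozenChain D G y₀ ξ n ω

section FrozenChain

variable {Ω : Type*} {D : Set ℝ} {G : ℝ → ℝ → ℝ} {y₀ : ℝ} {ξ : ℕ → Ω → ℝ}

lemma frozenChain_succ_of_mem {n : ℕ} {ω : Ω} (h : frozenChain D G y₀ ξ n ω ∈ D) :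
    frozenChain D G y₀ ξ (n + 1) ω = G (frozenChain D G y₀ ξ n ω) (ξ n ω) := if_pos h

lemma frozenChain_succ_of_notMem {n : ℕ} {ω : Ω} (h : frozenChain D G y₀ ξ n ω ∉ D) :
    frozenChain D G y₀ ξ (n + 1) ω = frozenChain D G y₀ ξ n ω := if_neg h

/-- A frozen chain never returns to `D`, so its final state alone records whether it ever left. -/
lemma frozenChain_mem_of_le {m n : ℕ} (hmn : m ≤ n) {ω : Ω}
    (h : frozenChain D G y₀ ξ n ω ∈ D) : frozenChain D G y₀ ξ m ω ∈ D := by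
  induction n, hmn using Nat.le_induction with
  | base => exact h
  | succ k _ ih =>
    refine ih ?_
    by_contra hk
    exact hk (frozenChain_succ_of_notMem hk ▸ h)

lemma measurable_frozenStep (hD : MeasurableSet D) (hG : Measurable (Function.uncurry G)) :
    Measurable (fun z : ℝ × ℝ => open Classical in if z.1 ∈ D then G z.1 z.2 else z.1) :=
  Measurable.ite (measurable_fst hD) hG measurable_fst

/-- The state at time `n` uses only inputs with index below `n`, hence its measurability and its
independence of `ξ n`. -/
lemma exists_frozenChain_eq (hD : MeasurableSet D) (hG : Measurable (Function.uncurry G)) (n : ℕ) :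
    ∃ g : (Finset.range n → ℝ) → ℝ, Measurable g ∧
      ∀ ω, frozenChain D G y₀ ξ n ω = g (fun i => ξ i ω) := by
  induction n with
  | zero => exact ⟨fun _ => y₀, measurable_const, fun _ => rfl⟩
  | succ n ih =>
    obtain ⟨g, hg, hgX⟩ := ih
    have hsub (i : Finset.range n) : (i : ℕ) ∈ Finset.range (n + 1) :=
      Finset.mem_range.2 ((Finset.mem_range.1 i.2).trans n.lt_succ_self)
    refine ⟨fun v => (fun z : ℝ × ℝ => open Classical in if z.1 ∈ D then G z.1 z.2 else z.1)
      (g fun i => v ⟨i, hsub i⟩, v ⟨n, Finset.self_mem_range_succ n⟩), ?_, fun ω => ?_⟩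
    · refine (measurable_frozenStep hD hG).comp (Measurable.prodMk (hg.comp ?_) ?_)
      · exact measurable_pi_lambda _ fun i => measurable_pi_apply _
      · exact measurable_pi_apply _
    · change (open Classical in if frozenChain D G y₀ ξ n ω ∈ D then
        G (frozenChain D G y₀ ξ n ω) (ξ n ω) else frozenChain D G y₀ ξ n ω) = _
      rw [hgX ω]

variable [MeasurableSpace Ω] {P : Measure Ω}

lemma aemeasurable_frozenChain (hD : MeasurableSet D) (hG : Measurable (Function.uncurry G))
    (hξ : ∀ n, AEMeasurable (ξ n) P) (n : ℕ) : AEMeasurable (frozenChain D G y₀ ξ n) P := by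
  obtain ⟨g, hg, hgX⟩ := exists_frozenChain_eq (y₀ := y₀) (ξ := ξ) hD hG n
  rw [funext hgX]
  exact hg.comp_aemeasurable (aemeasurable_pi_lambda _ fun i => hξ i)

lemma indepFun_frozenChain (hD : MeasurableSet D) (hG : Measurable (Function.uncurry G))
    (hξ : ∀ n, AEMeasurable (ξ n) P) (hind : iIndepFun ξ P) (n : ℕ) :
    IndepFun (frozenChain D G y₀ ξ n) (ξ n) P := by
  obtain ⟨g, hg, hgX⟩ := exists_frozenChain_eq (y₀ := y₀) (ξ := ξ) hD hG n
  have h := hind.indepFun_finset₀ (Finset.range n) {n} (by simp) hξ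
  have h2 := h.comp hg (measurable_pi_apply (⟨n, by simp⟩ : ({n} : Finset ℕ)))
  rw [funext hgX]
  exact h2

/-- One step of a chain with an independent input raises the mean of `U` by at most `c`, if it does
so from every deterministic state. -/
lemma integral_comp_le_of_indepFun [IsProbabilityMeasure P] {X Z : Ω → ℝ} (hX : AEMeasurable X P) (hZ : AEMeasurable Z P)
    (hind : IndepFun X Z P) {U : ℝ → ℝ} (hU : Measurable U) {K : ℝ} (hUK : ∀ x, |U x| ≤ K)
    {H : ℝ × ℝ → ℝ} (hH : Measurable H) {c : ℝ}
    (h : ∀ x, ∫ w, U (H (x, w)) ∂(P.map Z) ≤ U x + c) :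
    ∫ ω, U (H (X ω, Z ω)) ∂P ≤ ∫ ω, U (X ω) ∂P + c := by
  have := Measure.isProbabilityMeasure_map (μ := P) hX
  have := Measure.isProbabilityMeasure_map (μ := P) hZ
  have hUH : Measurable fun z => U (H z) := hU.comp hH
  have e1 : ∫ ω, U (H (X ω, Z ω)) ∂P = ∫ z, U (H z) ∂((P.map X).prod (P.map Z)) := by
    rw [← (indepFun_iff_map_prod_eq_prod_map_map hX hZ).1 hind,
      integral_map (hX.prodMk hZ) hUH.aestronglyMeasurable]
  have e2 : ∫ ω, U (X ω) ∂P = ∫ x, U x ∂(P.map X) := by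
    rw [integral_map hX hU.aestronglyMeasurable]
  have i1 : Integrable (fun z => U (H z)) ((P.map X).prod (P.map Z)) :=
    Integrable.of_bound hUH.aestronglyMeasurable K (Filter.Eventually.of_forall fun z => hUK _)
  have i2 : Integrable U (P.map X) :=
    Integrable.of_bound hU.aestronglyMeasurable K (Filter.Eventually.of_forall fun z => hUK _)
  rw [e1, e2, integral_prod _ i1]
  calc _ ≤ ∫ x, (U x + c) ∂(P.map X) :=
        integral_mono i1.integral_prod_left (i2.add (integrable_const c)) h
    _ = _ := by rw [integral_add i2 (integrable_const c)]; simp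

/-- Outside `D` the chain stands still, so with `0 ≤ c` the drift condition is needed on `D` only.
-/
lemma integral_frozenChain_le [IsProbabilityMeasure P] (hD : MeasurableSet D)
    (hG : Measurable (Function.uncurry G))
    (hξ : ∀ n, AEMeasurable (ξ n) P) (hind : iIndepFun ξ P)
    {U : ℝ → ℝ} (hU : Measurable U) {K : ℝ} (hUK : ∀ x, |U x| ≤ K) {c : ℝ} (hc : 0 ≤ c)
    (h : ∀ n, ∀ x ∈ D, ∫ w, U (G x w) ∂(P.map (ξ n)) ≤ U x + c) (n : ℕ) :
    ∫ ω, U (frozenChain D G y₀ ξ n ω) ∂P ≤ U y₀ + n * c := by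
  induction n with
  | zero => simp [frozenChain]
  | succ n ih =>
    have := Measure.isProbabilityMeasure_map (μ := P) (hξ n)
    have h1 := integral_comp_le_of_indepFun (aemeasurable_frozenChain (y₀ := y₀) hD hG hξ n) (hξ n)
      (indepFun_frozenChain hD hG hξ hind n) hU hUK (measurable_frozenStep hD hG) (c := c)
      (fun x => by
        by_cases hx : x ∈ D
        · simpa only [hx, if_true] using h n x hx
        · simpa [hx] using hc)
    push_cast
    simp only [frozenChain]
    linarith

end FrozenChain

/-! ### The frozen tamed chain driven by Brownian increments -/

namespace AitSahaliaParams

variable {Ω : Type*} {W : ℝ≥0 → Ω → ℝ} {τ : ℝ≥0}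

variable (p : AitSahaliaParams)

lemma measurable_tamedStep (t : ℝ) : Measurable (Function.uncurry (p.tamedStep t)) := by
  have hF := p.measurable_F
  unfold Function.uncurry tamedStep tamedF
  fun_prop

/-- The tamed chain without backstop, frozen outside a sublevel set of the Lyapunov function. -/
noncomputable def frozenTamedChain (W : ℝ≥0 → Ω → ℝ) (τ : ℝ≥0) (K y₀ : ℝ) : ℕ → Ω → ℝ :=
  frozenChain (lyapunovSublevel K) (p.tamedStep τ) y₀ (increment W τ)

/-- As long as the frozen chain is in the sublevel set, it agrees with the backstopped solution and
the backstop is not used. -/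
lemma mem_positivityEvent_of_frozenTamedChain_mem {N : ℕ} {y₀ K : ℝ} {Y : ℕ → Ω → ℝ} {ω : Ω}
    (h0 : Y 0 ω = y₀)
    (hacc : ∀ n < N, 0 < p.proposal W τ Y n ω → Y (n + 1) ω = p.proposal W τ Y n ω)
    (hmem : p.frozenTamedChain W τ K y₀ N ω ∈ lyapunovSublevel K) :
    ω ∈ p.positivityEvent W τ N Y := by
  have hall {n : ℕ} (hn : n ≤ N) : p.frozenTamedChain W τ K y₀ n ω ∈ lyapunovSublevel K :=
    frozenChain_mem_of_le hn hmem
  have hprop {n : ℕ} (hn : n < N) (hY : Y n ω = p.frozenTamedChain W τ K y₀ n ω) :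
      p.proposal W τ Y n ω = p.frozenTamedChain W τ K y₀ (n + 1) ω := by
    rw [proposal, hY]
    exact (frozenChain_succ_of_mem (hall hn.le)).symm
  have hY (n : ℕ) : n ≤ N → Y n ω = p.frozenTamedChain W τ K y₀ n ω := by
    induction n with
    | zero => exact fun _ => h0
    | succ n ih =>
      intro hn
      have e := hprop hn (ih (Nat.le_of_succ_le hn))
      rw [hacc n hn (e ▸ (hall hn).1), e]
  refine ⟨fun j hj => ?_, fun n hn => ?_⟩
  · rw [hY j hj]; exact (hall hj).1
  · rw [hprop hn (hY n hn.le)]; exact (hall hn).1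

variable [MeasurableSpace Ω] {P : Measure Ω}

lemma hasLaw_increment (hW : IsPreBrownianReal W P) (n : ℕ) :
    HasLaw (increment W τ n) (gaussianReal 0 τ) P := by
  have h := hW.hasLaw_sub (((n + 1 : ℕ) : ℝ≥0) * τ) ((n : ℝ≥0) * τ)
  have e : nndist (((n + 1 : ℕ) : ℝ≥0) * τ).1 ((n : ℝ≥0) * τ).1 = τ := by
    ext
    change |((((n + 1 : ℕ) : ℝ≥0) * τ : ℝ≥0) : ℝ) - (((n : ℝ≥0) * τ : ℝ≥0) : ℝ)| = τ
    push_cast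
    rw [show ((n : ℝ) + 1) * τ - n * τ = τ by ring, abs_of_nonneg τ.coe_nonneg]
  rw [e] at h
  exact h

lemma iIndepFun_increment (hW : IsPreBrownianReal W P) : iIndepFun (increment W τ) P :=
  hW.hasIndepIncrements.nat (t := fun n => (n : ℝ≥0) * τ)
    (fun _ _ h => mul_le_mul_of_nonneg_right (Nat.cast_le.2 h) τ.2)

/-- Markov's inequality for the exit of the frozen chain from the sublevel set. -/
lemma measureReal_frozenTamedChain_notMem_le [IsProbabilityMeasure P] (hW : IsPreBrownianReal W P)
    {K c y₀ : ℝ} (hK : 0 < K) (hc : 0 ≤ c)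
    (h : ∀ x ∈ lyapunovSublevel K,
      ∫ w, cutLyapunov K (p.tamedStep τ x w) ∂gaussianReal 0 τ ≤ cutLyapunov K x + c) (N : ℕ) :
    K * P.real {ω | p.frozenTamedChain W τ K y₀ N ω ∉ lyapunovSublevel K} ≤
      cutLyapunov K y₀ + N * c := by
  have hξ (n : ℕ) : AEMeasurable (increment W τ n) P := (hasLaw_increment hW n).aemeasurable
  have hbound (x : ℝ) : |cutLyapunov K x| ≤ K := by
    rw [abs_of_nonneg (cutLyapunov_nonneg hK.le x)]; exact cutLyapunov_le K x
  have h1 := integral_frozenChain_le (P := P) (y₀ := y₀) (measurableSet_lyapunovSublevel K)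
    (p.measurable_tamedStep τ) hξ (iIndepFun_increment hW) (measurable_cutLyapunov K) hbound hc
    (fun n x hx => by rw [(hasLaw_increment hW n).map_eq]; exact h x hx) N
  have hmeas : AEMeasurable (p.frozenTamedChain W τ K y₀ N) P :=
    aemeasurable_frozenChain (measurableSet_lyapunovSublevel K) (p.measurable_tamedStep τ) hξ N
  have hint : Integrable (fun ω => cutLyapunov K (p.frozenTamedChain W τ K y₀ N ω)) P :=
    Integrable.of_bound
      ((measurable_cutLyapunov K).comp_aemeasurable hmeas).aestronglyMeasurable K
      (Filter.Eventually.of_forall fun ω => hbound _)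
  have h2 := mul_meas_ge_le_integral_of_nonneg
    (Filter.Eventually.of_forall fun ω => cutLyapunov_nonneg hK.le _) hint K
  -- Markov's inequality at level `K` detects exit, since the cut-off function equals `K` off the
  -- sublevel set.
  refine le_trans (mul_le_mul_of_nonneg_left (measureReal_mono ?_) hK.le) (h2.trans h1)
  intro ω hω
  exact (cutLyapunov_of_notMem hω).ge

end AitSahaliaParams

/-! ### The main theorem -/

theorem mainTheorem2 {Ω : Type*} [MeasurableSpace Ω] (P : Measure Ω) [IsProbabilityMeasure P]
    (W : ℝ≥0 → Ω → ℝ) (hW : IsBrownianReal W P)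
    (p : AitSahaliaParams) (T : ℝ≥0) (hT : 0 < T)
    (M₁ y₀ : ℝ) (hy₀ : 0 < y₀) (hM₁ : y₀ ≤ M₁) (ε : ℝ) (hε : ε ∈ Set.Ioo (0 : ℝ) 1) :
    ∃ τ₀ : ℝ≥0, 0 < τ₀ ∧ ∀ N : ℕ, 0 < N → ∀ τ : ℝ≥0, τ = T / N → τ ≤ τ₀ →
      ∀ Y : ℕ → Ω → ℝ, p.IsBackstoppedSolution P W τ N y₀ Y →
        1 - ε < P.real (p.positivityEvent W τ N Y) ∧
          P.real (p.backstopEvent W τ N Y) < ε := by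
  obtain ⟨C, hC0, hC⟩ := p.exists_generator_le
  set b := y₀ - Real.log y₀ + (C + 1) * T with hb
  have hb0 : 0 < b := by
    have := one_le_sub_log hy₀
    have : 0 ≤ (C + 1) * (T : ℝ) := by positivity
    linarith
  -- The summand `1` makes `b < K * ε` strict.
  set K := b / ε + 1 with hKdef
  have hK : 0 < K := by have := div_pos hb0 hε.1; linarith
  obtain ⟨τ₀, hτ₀, hstep⟩ := p.exists_integral_cutLyapunov_tamedStep_le hC hK
  refine ⟨τ₀, hτ₀, fun N hN τ hτ hle Y hY => ?_⟩
  set D := lyapunovSublevel K with hD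
  set E := {ω | p.frozenTamedChain W τ K y₀ N ω ∉ D} with hE
  have hNτ : (N : ℝ) * τ = T := by
    have : (N : ℝ) ≠ 0 := by positivity
    rw [hτ]; push_cast; field_simp
  have hEε : P.real E < ε := by
    have h1 := p.measureReal_frozenTamedChain_notMem_le (y₀ := y₀) hW.toIsPreBrownianReal hK
      (c := (C + 1) * τ) (by positivity) (hstep τ hle) N
    have h2 := cutLyapunov_le_sub_log K hy₀
    have h3 : K * P.real E ≤ b := by
      rw [hb, ← hNτ]; linarith
    have h4 : b < K * ε := by
      rw [hKdef, add_mul, div_mul_cancel₀ _ hε.1.ne']; linarith [hε.1]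
    exact lt_of_mul_lt_mul_left (h3.trans_lt h4) hK.le
  -- The increments are used as a.e. measurable functions, so `E` is only shown to be null
  -- measurable.
  have hEmeas : NullMeasurableSet E P :=
    ((aemeasurable_frozenChain (measurableSet_lyapunovSublevel K) (p.measurable_tamedStep τ)
      (fun n => (AitSahaliaParams.hasLaw_increment hW.toIsPreBrownianReal n).aemeasurable)
      N).nullMeasurable (measurableSet_lyapunovSublevel K)).compl
  have hpos : ∀ᵐ ω ∂P, ω ∈ Eᶜ → ω ∈ p.positivityEvent W τ N Y := by
    filter_upwards [hY.initial, hY.accept] with ω h0 hacc hω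
    exact p.mem_positivityEvent_of_frozenTamedChain_mem h0 hacc (not_not.1 hω)
  constructor
  · have h1 : P.real Eᶜ ≤ P.real (p.positivityEvent W τ N Y) :=
      ENNReal.toReal_mono (measure_ne_top _ _) (measure_mono_ae hpos)
    rw [probReal_compl_eq_one_sub₀ hEmeas] at h1
    linarith
  · refine lt_of_le_of_lt (ENNReal.toReal_mono (measure_ne_top _ _) (measure_mono_ae ?_)) hEε
    filter_upwards [hpos] with ω hω hback
    by_contra hω'
    obtain ⟨n, hn, hle⟩ := hback
    exact absurd ((hω hω').2 n hn) (not_lt.2 hle)
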